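/- Let $\mathcal D$ be a subgaussian probability distribution on $\mathbb R$ (that is, for some $L>0$, a random variable $Z\sim\mathcal D$ satisfies $\Pr[|Z|\ge Lu]\le 2e^{-u^2/2}$ for all $u\ge 1$) with mean $0$ and variance $1$. Then there exist constants $0<\mu<1$, $\kappa_0>1$, $c>0$ and $\alpha>0$, which may depend on $\mathcal D$ but not on the dimension $n$, such that the following holds. For all sufficiently large $n$ and for all $m\ge\kappa_0 n$, let $a_1,\dots,a_m\in\mathbb R^n$ be independent random vectors whose entries $a_{ij}$ are sampled independently from $\mathcal D$, and let $\mathcal A:\mathbb R^{n\times n}\to\mathbb R^m$, $\mathcal A(X)=\bigl(\operatorname{Tr}(a_ia_i^TX)\bigr)_{i=1}^m$, be the sampling operator. Then with probability at least $1-e^{-cn}$ over the choice of the $a_i$, $$\tfrac1m\|\mathcal A(X)\|_1\ \ge\ \alpha\,\|X\|$$ holds simultaneously for every nonzero $\mu$-flat vector $x_0\in\mathbb R^n$ (that is, every $x_0\neq 0$ with $\|x_0\|_\infty\le\mu\|x_0\|_2$) and every nonzero matrix $X\in T(x_0)=\{xx_0^T+x_0x^T : x\in\mathbb R^n\}$.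 Here $\|X\|$ denotes the operator (spectral) norm. -/

import Mathlib

open MeasureTheory ProbabilityTheory

noncomputable section

namespace PhaseLift

/-- The distribution `D` on `ℝ` is subgaussian with parameter `L`:
`Pr[|X| ≥ L u] ≤ 2 exp (-u² / 2)` for every `u ≥ 1`, where `X` is distributed as `D`. -/
def IsSubgaussianWith (D : Measure ℝ) (L : ℝ) : Prop :=
  ∀ u : ℝ, 1 ≤ u → D.real {x : ℝ | L * u ≤ |x|} ≤ 2 * Real.exp (-u ^ 2 / 2)

/-- The distribution `D` on `ℝ` is subgaussian, with some parameter `L > 0`. -/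
def IsSubgaussian (D : Measure ℝ) : Prop :=
  ∃ L : ℝ, 0 < L ∧ IsSubgaussianWith D L

/-- The joint law of `m` independent measurement vectors `a 0, …, a (m - 1)` in `ℝⁿ`,
each of which has independent entries `a i j` with distribution `D`. -/
def measurementLaw (D : Measure ℝ) (m n : ℕ) : Measure (Fin m → Fin n → ℝ) :=
  Measure.pi fun _ : Fin m => Measure.pi fun _ : Fin n => D

/-- The vector `x` is `μ`-flat: `‖x‖_∞ ≤ μ ‖x‖₂`.
The norm on `Fin n → ℝ` is the maximum norm, that on `EuclideanSpace` the Euclidean norm. -/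
def IsFlat {n : ℕ} (μ : ℝ) (x : EuclideanSpace ℝ (Fin n)) : Prop :=
  ‖(WithLp.ofLp x : Fin n → ℝ)‖ ≤ μ * ‖x‖

/-- The set `S(μ)` of all `μ`-flat vectors in `ℝⁿ`. -/
def flatVectors (n : ℕ) (μ : ℝ) : Set (EuclideanSpace ℝ (Fin n)) :=
  {x | IsFlat μ x}

/-- The tangent space `T(x₀) = {x x₀ᵀ + x₀ xᵀ | x ∈ ℝⁿ}`. -/
def tangentSpace {n : ℕ} (x₀ : EuclideanSpace ℝ (Fin n)) : Set (Matrix (Fin n) (Fin n) ℝ) :=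
  {X | ∃ x : EuclideanSpace ℝ (Fin n),
    X = Matrix.vecMulVec x.ofLp x₀.ofLp + Matrix.vecMulVec x₀.ofLp x.ofLp}

/-- The sampling operator `𝒜(X) = (Tr (a i (a i)ᵀ X))_i`. -/
def samplingOperator {m n : ℕ} (a : Fin m → Fin n → ℝ) (X : Matrix (Fin n) (Fin n) ℝ) :
    Fin m → ℝ :=
  fun i => (Matrix.vecMulVec (a i) (a i) * X).trace

/-- The `ℓ₁` norm on `ℝᵐ`. -/
def l1Norm {m : ℕ} (y : Fin m → ℝ) : ℝ :=
  ∑ i, |y i|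

/-- The operator (spectral) norm of a real square matrix, with respect to Euclidean norms. -/
def operatorNorm {n : ℕ} (X : Matrix (Fin n) (Fin n) ℝ) : ℝ :=
  ‖Matrix.toEuclideanCLM (n := Fin n) (𝕜 := ℝ) X‖

end PhaseLift

end

/-!
Every `X` in `T(x₀)` has the form `x x₀ᵀ + x₀ xᵀ`, and then `aᵀ X a = 2 ⟨a, x⟩ ⟨a, x₀⟩` while
`‖X‖ ≤ 2 ‖x‖ ‖x₀‖`. By homogeneity it suffices to bound `∑ i, |⟨aᵢ, x⟩| |⟨aᵢ, x₀⟩|` from below by a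
multiple of `m`, uniformly over unit vectors `x` and flat unit vectors `x₀`
(`operatorNorm_le_l1Norm_of_unit`).

For one pair this is a joint small-ball estimate (`IsSubgaussian.exists_joint_smallBall`): with
probability at least `q > 0` both `|⟨a, x⟩|` and `|⟨a, x₀⟩|` are at least `t`. For an arbitrary unit
vector `x`, `⟨a, x⟩` has second moment one and a square-exponential moment bounded independently of
the dimension, so `⟨a, x⟩² ≥ 1/2` has probability bounded below
(`le_measureReal_half_le_sq`, an inequality of Paley–Zygmund type). This lower bound may be far from
one (for Rademacher entries, `⟨a, x⟩` may vanish with probability one half), and this is where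
flatness enters: the characteristic function of `⟨a, x₀⟩` is `∏ j, φ (u x₀ⱼ)`, which is at most
`exp (-u² / 4)` for all `u` up to a constant times `1 / μ`, so that after Gaussian smoothing
`|⟨a, x₀⟩| < t` has probability as small as desired (`measureReal_abs_dotProduct_lt_le`).

By a Chernoff bound, with probability `1 - exp (-q m / 4)` a proportion `q / 4` of the `aᵢ` is large
on a fixed pair (`measureReal_pi_sum_indicator_le`). A union bound over `ε`-nets with at most
`(3 / ε) ^ n` points, absorbed by `m ≥ κ₀ n`, gives this for all pairs of net points
(`measureReal_exists_bad_le`). The passage from the nets to all pairs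
(`sum_abs_mul_abs_ge_of_nets`) is controlled by `∑ i, ⟨aᵢ, z⟩² ≤ C m ‖z‖²`, which follows from the
square-exponential moments by the same kind of net argument (`sum_dotProduct_sq_le_of_net`).
-/

namespace PhaseLift

/-! ### Subgaussian tails and square-exponential moments -/

/-- A subgaussian tail gives a square-exponential moment bounded by an absolute constant. The
proof decomposes the space into the shells `L k ≤ |Y| < L (k + 1)`. -/
theorem integral_exp_sq_le {Ω : Type*} [MeasurableSpace Ω] {ν : Measure Ω}
    [IsProbabilityMeasure ν] {Y : Ω → ℝ} (hY : Measurable Y) {L : ℝ} (hL : 0 < L)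
    (htail : ∀ u : ℝ, 1 ≤ u → ν.real {ω | L * u ≤ |Y ω|} ≤ 2 * Real.exp (-u ^ 2 / 2)) :
    Integrable (fun ω => Real.exp (Y ω ^ 2 / (16 * L ^ 2))) ν ∧
      ∫ ω, Real.exp (Y ω ^ 2 / (16 * L ^ 2)) ∂ν ≤ 10 := by
  set A : ℕ → Set Ω := fun k => {ω | L * k ≤ |Y ω|} with hA
  have hAm : ∀ k, MeasurableSet (A k) := fun k =>
    measurableSet_le measurable_const (hY.norm)
  set w : ℕ → ENNReal := fun k => ENNReal.ofReal (Real.exp (((k : ℝ) + 1) ^ 2 / 16)) with hw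
  have hpt : ∀ ω, ENNReal.ofReal (Real.exp (Y ω ^ 2 / (16 * L ^ 2)))
      ≤ ∑' k, (A k).indicator (fun _ => w k) ω := by
    intro ω
    refine le_trans ?_ (ENNReal.le_tsum ⌊|Y ω| / L⌋₊)
    have h1 : (⌊|Y ω| / L⌋₊ : ℝ) ≤ |Y ω| / L := Nat.floor_le (by positivity)
    have h2 : |Y ω| / L < ⌊|Y ω| / L⌋₊ + 1 := Nat.lt_floor_add_one _
    rw [Set.indicator_of_mem]
    · apply ENNReal.ofReal_le_ofReal
      apply Real.exp_le_exp.2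
      have : Y ω ^ 2 / (16 * L ^ 2) = (|Y ω| / L) ^ 2 / 16 := by
        rw [div_pow, sq_abs]; field_simp
      rw [this]
      gcongr
    · rw [le_div_iff₀ hL] at h1
      simp only [hA, Set.mem_ofPred_eq]
      linarith
  have hterm : ∀ k : ℕ, w k * ν (A k) ≤ 2 * ENNReal.ofReal (4 / 5) ^ k := by
    intro k
    have hr : Real.exp (((k : ℝ) + 1) ^ 2 / 16) * ν.real (A k) ≤ 2 * (4 / 5) ^ k := by
      rcases Nat.eq_zero_or_pos k with rfl | hk
      -- The tail hypothesis says nothing about `u = 0`; the trivial bound `1` serves there.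
      · have h1 : ν.real (A 0) ≤ 1 := measureReal_le_one
        have h2 : Real.exp (((0 : ℕ) + 1 : ℝ) ^ 2 / 16) ≤ 2 := by
          have : Real.exp (((0 : ℕ) + 1 : ℝ) ^ 2 / 16) ≤ Real.exp (Real.log 2) := by
            apply Real.exp_le_exp.2
            have := Real.log_two_gt_d9
            norm_num
            linarith
          rwa [Real.exp_log (by norm_num)] at this
        simpa using mul_le_mul h2 h1 measureReal_nonneg (by norm_num)
      · have hk1 : (1 : ℝ) ≤ k := by exact_mod_cast hk
        have h45 : Real.exp (-(1 / 4)) ≤ 4 / 5 := by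
          rw [Real.exp_neg, inv_le_comm₀ (Real.exp_pos _) (by norm_num)]
          have := Real.add_one_le_exp (1 / 4 : ℝ)
          norm_num at this ⊢
          linarith
        calc Real.exp (((k : ℝ) + 1) ^ 2 / 16) * ν.real (A k)
            ≤ Real.exp (((k : ℝ) + 1) ^ 2 / 16) * (2 * Real.exp (-(k : ℝ) ^ 2 / 2)) := by
              gcongr
              exact htail k hk1
          _ = 2 * Real.exp (((k : ℝ) + 1) ^ 2 / 16 + -(k : ℝ) ^ 2 / 2) := by
              rw [Real.exp_add]; ring
          _ ≤ 2 * Real.exp (k * (-(1 / 4))) := by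
              gcongr
              nlinarith
          _ ≤ 2 * (4 / 5) ^ k := by
              rw [Real.exp_nat_mul]
              gcongr
    have hνA : ν (A k) = ENNReal.ofReal (ν.real (A k)) := by
      rw [measureReal_def, ENNReal.ofReal_toReal (measure_ne_top _ _)]
    rw [hνA, hw, ← ENNReal.ofReal_mul (Real.exp_pos _).le, ← ENNReal.ofReal_pow (by norm_num),
      ← ENNReal.ofReal_ofNat, ← ENNReal.ofReal_mul (by norm_num)]
    exact ENNReal.ofReal_le_ofReal hr
  have hlint : ∫⁻ ω, ENNReal.ofReal (Real.exp (Y ω ^ 2 / (16 * L ^ 2))) ∂ν ≤ ENNReal.ofReal 10 := by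
    calc ∫⁻ ω, ENNReal.ofReal (Real.exp (Y ω ^ 2 / (16 * L ^ 2))) ∂ν
        ≤ ∫⁻ ω, ∑' k, (A k).indicator (fun _ => w k) ω ∂ν := lintegral_mono hpt
      _ = ∑' k, ∫⁻ ω, (A k).indicator (fun _ => w k) ω ∂ν :=
          lintegral_tsum fun k => (measurable_const.indicator (hAm k)).aemeasurable
      _ = ∑' k, w k * ν (A k) := by
          congr 1; ext k
          rw [lintegral_indicator_const (hAm k)]
      _ ≤ ∑' k, 2 * ENNReal.ofReal (4 / 5) ^ k := ENNReal.tsum_le_tsum hterm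
      _ = ENNReal.ofReal 10 := by
          rw [ENNReal.tsum_mul_left, ENNReal.tsum_geometric, ← ENNReal.ofReal_one,
            ← ENNReal.ofReal_sub _ (by norm_num), ← ENNReal.ofReal_inv_of_pos (by norm_num),
            ← ENNReal.ofReal_ofNat, ← ENNReal.ofReal_mul (by norm_num)]
          norm_num
  have hmeas : Measurable (fun ω => Real.exp (Y ω ^ 2 / (16 * L ^ 2))) := by fun_prop
  have hint : Integrable (fun ω => Real.exp (Y ω ^ 2 / (16 * L ^ 2))) ν := by
    refine ⟨hmeas.aestronglyMeasurable, ?_⟩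
    rw [hasFiniteIntegral_iff_ofReal (Filter.Eventually.of_forall fun _ => (Real.exp_pos _).le)]
    exact hlint.trans_lt ENNReal.ofReal_lt_top
  refine ⟨hint, ?_⟩
  rw [← ofReal_integral_eq_lintegral_ofReal hint
    (Filter.Eventually.of_forall fun _ => (Real.exp_pos _).le)] at hlint
  exact (ENNReal.ofReal_le_ofReal_iff (by norm_num)).1 hlint

theorem exp_le_add_exp_sq (x : ℝ) : Real.exp x ≤ x + Real.exp (x ^ 2) := by
  have h := Real.add_one_le_exp (x ^ 2)
  rcases le_total |x| 1 with hx | hx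
  · have := (abs_le.1 (Real.abs_exp_sub_one_sub_id_le hx)).2
    linarith
  · rcases le_abs.1 hx with hx | hx
    · have : Real.exp x ≤ Real.exp (x ^ 2) := Real.exp_le_exp.2 (by nlinarith)
      linarith
    · have : Real.exp x ≤ 1 := Real.exp_le_one_iff.2 (by linarith)
      nlinarith

/-- A centred variable with a square-exponential moment has a subgaussian moment generating
function. For `s² ≤ η` the inequality `exp y ≤ y + exp (y²)` removes the linear term, whose mean
is zero; for larger `s`, Young's inequality is enough. -/
theorem hasSubgaussianMGF_of_integral_exp_sq_le {D : Measure ℝ} [IsProbabilityMeasure D]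
    (hmean : ∫ x, x ∂D = 0) {η : NNReal} (hη : 0 < η)
    (hint : Integrable (fun x : ℝ => Real.exp (η * x ^ 2)) D)
    (hle : ∫ x, Real.exp (η * x ^ 2) ∂D ≤ 10) :
    HasSubgaussianMGF (fun x : ℝ => x) (18 / η) D := by
  have hη' : (0 : ℝ) < η := hη
  have hyoung : ∀ s x : ℝ, Real.exp (s * x) ≤
      Real.exp (s ^ 2 / η) * Real.exp (η * x ^ 2) := by
    intro s x
    rw [← Real.exp_add, Real.exp_le_exp]
    have h1 : s ^ 2 / η + η * x ^ 2 - s * x = ((s / η - x / 2) ^ 2 + 3 / 4 * x ^ 2) * η := by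
      field_simp; ring
    have h2 : 0 ≤ ((s / η - x / 2) ^ 2 + 3 / 4 * x ^ 2) * (η : ℝ) := by positivity
    linarith
  have hexp : ∀ s : ℝ, Integrable (fun x : ℝ => Real.exp (s * x)) D := fun s =>
    (hint.const_mul (Real.exp (s ^ 2 / η))).mono' (by fun_prop)
      (Filter.Eventually.of_forall fun x => by
        rw [Real.norm_eq_abs, abs_of_pos (Real.exp_pos _)]
        exact hyoung s x)
  have hid : Integrable (fun x : ℝ => x) D := by
    refine (((hexp 1).add (hexp (-1)))).mono' (by fun_prop)
      (Filter.Eventually.of_forall fun x => ?_)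
    have h1 := Real.add_one_le_exp (1 * x)
    have h2 := Real.add_one_le_exp (-1 * x)
    have h3 := Real.exp_pos (1 * x)
    have h4 := Real.exp_pos (-1 * x)
    rw [Real.norm_eq_abs, abs_le]
    simp only [Pi.add_apply]
    constructor <;> linarith
  refine ⟨hexp, fun s => ?_⟩
  have hcast : ((18 / η : NNReal) : ℝ) * s ^ 2 / 2 = 9 * (s ^ 2 / η) := by
    push_cast; ring
  rw [hcast, mgf]
  set θ : ℝ := s ^ 2 / η with hθ
  have hθ0 : 0 ≤ θ := by positivity
  rcases le_or_gt θ 1 with h1 | h1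
  · have hpt : ∀ x : ℝ, Real.exp (s * x) ≤ s * x + ((1 - θ) + θ * Real.exp (η * x ^ 2)) := by
      intro x
      refine (exp_le_add_exp_sq _).trans ?_
      -- `exp ((s x)²) = exp (θ (η x²))`, and convexity bounds this by a chord since `θ ≤ 1`.
      have hc := convexOn_exp.2 (Set.mem_univ (0 : ℝ)) (Set.mem_univ (η * x ^ 2))
        (sub_nonneg.2 h1) hθ0 (by ring)
      have he : (s * x) ^ 2 = θ * (η * x ^ 2) := by
        rw [hθ]; field_simp
      simp only [smul_eq_mul, mul_zero, zero_add, Real.exp_zero, mul_one] at hc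
      rw [he]
      linarith
    have hI : Integrable (fun x : ℝ => (1 - θ) + θ * Real.exp (η * x ^ 2)) D :=
      (integrable_const _).add (hint.const_mul θ)
    calc ∫ x, Real.exp (s * x) ∂D
        ≤ ∫ x, (s * x + ((1 - θ) + θ * Real.exp (η * x ^ 2))) ∂D :=
          integral_mono (hexp s) ((hid.const_mul s).add hI) hpt
      _ = (1 - θ) + θ * ∫ x, Real.exp (η * x ^ 2) ∂D := by
          rw [integral_add (hid.const_mul s) hI, integral_const_mul, hmean,
            integral_add (integrable_const _) (hint.const_mul θ), integral_const_mul]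
          simp
      _ ≤ 9 * θ + 1 := by nlinarith
      _ ≤ Real.exp (9 * θ) := Real.add_one_le_exp _
  · calc ∫ x, Real.exp (s * x) ∂D
        ≤ ∫ x, Real.exp θ * Real.exp (η * x ^ 2) ∂D :=
          integral_mono (hexp s) (hint.const_mul _) (hyoung s)
      _ = Real.exp θ * ∫ x, Real.exp (η * x ^ 2) ∂D := integral_const_mul _ _
      _ ≤ Real.exp θ * Real.exp (8 * θ) := by
          gcongr
          have h2 : (2 : ℝ) ≤ Real.exp 1 := by
            have := Real.add_one_le_exp (1 : ℝ); linarith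
          have h3 : (10 : ℝ) ≤ Real.exp 8 := by
            calc (10 : ℝ) ≤ 2 ^ 8 := by norm_num
              _ ≤ Real.exp 1 ^ 8 := by gcongr
              _ = Real.exp 8 := by rw [← Real.exp_nat_mul]; norm_num
          exact hle.trans (h3.trans (Real.exp_le_exp.2 (by linarith)))
      _ = Real.exp (9 * θ) := by rw [← Real.exp_add]; ring_nf

theorem IsSubgaussian.exists_hasSubgaussianMGF {D : Measure ℝ} [IsProbabilityMeasure D]
    (hD : IsSubgaussian D) (hmean : ∫ x, x ∂D = 0) :
    ∃ K : NNReal, 0 < K ∧ HasSubgaussianMGF (fun x : ℝ => x) K D := by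
  obtain ⟨L, hL, hLD⟩ := hD
  obtain ⟨hint, hle⟩ := integral_exp_sq_le (ν := D) measurable_id hL hLD
  set η : NNReal := ⟨1 / (16 * L ^ 2), by positivity⟩ with hη
  have hη0 : 0 < η := by
    rw [← NNReal.coe_pos]; change 0 < 1 / (16 * L ^ 2); positivity
  have he : ∀ x : ℝ, id x ^ 2 / (16 * L ^ 2) = η * x ^ 2 := fun x => by
    change x ^ 2 / (16 * L ^ 2) = 1 / (16 * L ^ 2) * x ^ 2
    ring
  simp_rw [he] at hint hle
  exact ⟨18 / η, by positivity, hasSubgaussianMGF_of_integral_exp_sq_le hmean hη0 hint hle⟩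

theorem hasSubgaussianMGF_dotProduct {D : Measure ℝ} [IsProbabilityMeasure D] {K : NNReal}
    (hK : HasSubgaussianMGF (fun x : ℝ => x) K D) {n : ℕ} {x : EuclideanSpace ℝ (Fin n)}
    (hx : ‖x‖ = 1) :
    HasSubgaussianMGF (fun b : Fin n → ℝ => b ⬝ᵥ x.ofLp) K (Measure.pi fun _ => D) := by
  have hsub : ∀ j : Fin n, HasSubgaussianMGF (fun b : Fin n → ℝ => x j * b j)
      (‖x j‖₊ ^ 2 * K) (Measure.pi fun _ => D) := by
    intro j
    have hsq : (‖x j‖₊ ^ 2 : NNReal) = ⟨x j ^ 2, sq_nonneg _⟩ := NNReal.eq (by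
      simp only [NNReal.coe_pow, coe_nnnorm, Real.norm_eq_abs, sq_abs]; rfl)
    rw [hsq]
    refine HasSubgaussianMGF.const_mul (X := fun b : Fin n → ℝ => b j) ?_ (x j)
    refine HasSubgaussianMGF.of_map (X := fun x : ℝ => x) (Y := fun b : Fin n → ℝ => b j)
      (measurable_pi_apply j).aemeasurable ?_
    rwa [(measurePreserving_eval (fun _ : Fin n => D) j).map_eq]
  have hind : iIndepFun (fun (j : Fin n) (b : Fin n → ℝ) => x j * b j)
      (Measure.pi fun _ => D) :=
    iIndepFun_pi (X := fun (j : Fin n) (y : ℝ) => x j * y) (fun j => by fun_prop)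
  have h := HasSubgaussianMGF.sum_of_iIndepFun hind (s := Finset.univ) (fun j _ => hsub j)
  have hc : ∑ j : Fin n, ‖x j‖₊ ^ 2 * K = K := by
    rw [← Finset.sum_mul]
    have : ∑ j : Fin n, ‖x j‖₊ ^ 2 = 1 := by
      rw [← NNReal.coe_inj]
      push_cast
      have := EuclideanSpace.real_norm_sq_eq x
      rw [hx] at this
      simpa using this.symm
    rw [this, one_mul]
  rw [hc] at h
  refine h.congr (Filter.Eventually.of_forall fun b => ?_)
  simp [dotProduct, mul_comm]

/-- The marginals `⟨b, x⟩` in unit directions `x` have square-exponential moments bounded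
uniformly in the direction and in the dimension. -/
theorem IsSubgaussian.exists_integral_exp_dotProduct_sq_le {D : Measure ℝ}
    [IsProbabilityMeasure D] (hD : IsSubgaussian D) (hmean : ∫ x, x ∂D = 0) :
    ∃ l : ℝ, 0 < l ∧ ∀ (n : ℕ) (x : EuclideanSpace ℝ (Fin n)), ‖x‖ = 1 →
      Integrable (fun b : Fin n → ℝ => Real.exp (l * (b ⬝ᵥ x.ofLp) ^ 2)) (Measure.pi fun _ => D) ∧
      ∫ b : Fin n → ℝ, Real.exp (l * (b ⬝ᵥ x.ofLp) ^ 2) ∂(Measure.pi fun _ => D) ≤ 10 := by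
  obtain ⟨K, hK0, hK⟩ := hD.exists_hasSubgaussianMGF hmean
  have hK' : (0 : ℝ) < K := hK0
  refine ⟨1 / (16 * K), by positivity, fun n x hx => ?_⟩
  have hsub := hasSubgaussianMGF_dotProduct hK hx
  have hmeas : Measurable (fun b : Fin n → ℝ => b ⬝ᵥ x.ofLp) := by
    unfold dotProduct; fun_prop
  have h := integral_exp_sq_le (ν := Measure.pi fun _ : Fin n => D) hmeas (Real.sqrt_pos.2 hK')
    fun u hu => by
      have hu0 : 0 ≤ Real.sqrt K * u := by positivity
      have h1 := hsub.measure_ge_le hu0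
      have h2 := hsub.neg.measure_ge_le hu0
      have he : -(Real.sqrt K * u) ^ 2 / (2 * K) = -u ^ 2 / 2 := by
        rw [mul_pow, Real.sq_sqrt hK'.le]; field_simp
      rw [he] at h1 h2
      have hsubset : {b : Fin n → ℝ | Real.sqrt K * u ≤ |b ⬝ᵥ x.ofLp|} ⊆
          {b | Real.sqrt K * u ≤ b ⬝ᵥ x.ofLp} ∪
            {b | Real.sqrt K * u ≤ (-fun b : Fin n → ℝ => b ⬝ᵥ x.ofLp) b} := by
        intro b hb
        have hb' : Real.sqrt K * u ≤ |b ⬝ᵥ x.ofLp| := hb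
        exact le_abs.1 hb'
      calc _ ≤ _ := measureReal_mono hsubset
        _ ≤ _ := measureReal_union_le _ _
        _ ≤ _ := by linarith
  have he : ∀ y : ℝ, y ^ 2 / (16 * Real.sqrt K ^ 2) = 1 / (16 * K) * y ^ 2 := fun y => by
    rw [Real.sq_sqrt hK'.le]; ring
  simp_rw [he] at h
  exact h

/-! ### Small-ball estimates -/

/-- A variable with second moment one and a bounded square-exponential moment is bounded away from
zero with probability bounded below. The exponential moment plays the role of the fourth moment in
the Paley–Zygmund inequality. -/
theorem le_measureReal_half_le_sq {Ω : Type*} [MeasurableSpace Ω] {ν : Measure Ω}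
    [IsProbabilityMeasure ν] {Y : Ω → ℝ} (hY : Measurable Y) {l : ℝ} (hl : 0 < l)
    (hint : Integrable (fun ω => Real.exp (l * Y ω ^ 2)) ν)
    (hle : ∫ ω, Real.exp (l * Y ω ^ 2) ∂ν ≤ 10) (hsq : ∫ ω, Y ω ^ 2 ∂ν = 1) :
    l ^ 2 / 80 ≤ ν.real {ω | 1 / 2 ≤ Y ω ^ 2} := by
  set A : Set Ω := {ω | 1 / 2 ≤ Y ω ^ 2} with hA
  have hAm : MeasurableSet A := measurableSet_le measurable_const (hY.pow_const 2)
  have hpt : ∀ ω, Y ω ^ 2 ≤ 1 / 2 + (1 / 40 * Real.exp (l * Y ω ^ 2) +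
      A.indicator (fun _ => 20 / l ^ 2) ω) := by
    intro ω
    by_cases hω : ω ∈ A
    · rw [Set.indicator_of_mem hω]
      have h1 := Real.quadratic_le_exp_of_nonneg (x := l * Y ω ^ 2) (by positivity)
      have h2 : (l * Y ω ^ 2) ^ 2 / 80 + 20 / l ^ 2 - Y ω ^ 2 =
          (l * Y ω ^ 2 - 40 / l) ^ 2 / 80 := by
        field_simp; ring
      have h3 : 0 ≤ (l * Y ω ^ 2 - 40 / l) ^ 2 / 80 := by positivity
      have h4 : 0 ≤ l * Y ω ^ 2 := by positivity
      linarith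
    · rw [Set.indicator_of_notMem hω]
      have h1 : Y ω ^ 2 < 1 / 2 := not_le.1 hω
      have h2 := Real.exp_pos (l * Y ω ^ 2)
      linarith
  have hI : Integrable (A.indicator (fun _ => 20 / l ^ 2)) ν :=
    (integrable_const _).indicator hAm
  have hI2 : Integrable (fun ω => Y ω ^ 2) ν := .of_integral_ne_zero (by rw [hsq]; norm_num)
  have hI3 : Integrable (fun ω => 1 / 40 * Real.exp (l * Y ω ^ 2) +
      A.indicator (fun _ => 20 / l ^ 2) ω) ν := (hint.const_mul _).add hI
  have hmono := integral_mono hI2 ((integrable_const (1 / 2 : ℝ)).add hI3) hpt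
  simp only [Pi.add_apply] at hmono
  rw [hsq, integral_add (integrable_const _) hI3,
    integral_add (hint.const_mul _) hI, integral_const_mul, integral_indicator_const _ hAm] at hmono
  simp only [integral_const, probReal_univ, smul_eq_mul] at hmono
  have h5 : 1 / 4 ≤ ν.real A * (20 / l ^ 2) := by linarith
  have h6 : ν.real A = (ν.real A * (20 / l ^ 2)) * (l ^ 2 / 20) := by field_simp
  rw [h6]
  have h7 : 0 < l ^ 2 / 20 := by positivity
  nlinarith

theorem measurable_dotProduct_left {n : ℕ} (x : Fin n → ℝ) :
    Measurable (fun b : Fin n → ℝ => b ⬝ᵥ x) := by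
  unfold dotProduct; fun_prop

theorem integral_dotProduct_sq {D : Measure ℝ} [IsProbabilityMeasure D]
    (hL2 : MemLp (fun x : ℝ => x) 2 D) (hmean : ∫ x, x ∂D = 0)
    (hvar : variance (fun x : ℝ => x) D = 1) {n : ℕ} (x : EuclideanSpace ℝ (Fin n)) :
    ∫ b : Fin n → ℝ, (b ⬝ᵥ x.ofLp) ^ 2 ∂(Measure.pi fun _ => D) = ‖x‖ ^ 2 := by
  have hLp : ∀ j : Fin n, MemLp (fun y : ℝ => x j * y) 2 D := fun j => hL2.const_mul (x j)
  have h := variance_sum_pi (μ := fun _ : Fin n => D) (X := fun j y => x j * y) hLp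
  have hfun : (∑ j : Fin n, fun b : Fin n → ℝ => x j * b j) = fun b => b ⬝ᵥ x.ofLp := by
    ext b
    simp [dotProduct, mul_comm]
  rw [hfun, variance_of_integral_eq_zero (measurable_dotProduct_left _).aemeasurable] at h
  · rw [h, EuclideanSpace.real_norm_sq_eq]
    refine Finset.sum_congr rfl fun j _ => ?_
    rw [variance_const_mul, hvar, mul_one]
  · simp only [dotProduct]
    rw [integral_finsetSum]
    · refine Finset.sum_eq_zero fun j _ => ?_
      rw [integral_mul_const,
        integral_comp_eval (μ := fun _ : Fin n => D) (f := fun y : ℝ => y) (by fun_prop), hmean,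
        zero_mul]
    · intro j _
      have hi := (hL2.integrable one_le_two).mul_const (x j)
      exact (measurePreserving_eval (fun _ : Fin n => D) j).integrable_comp_of_integrable hi

open Complex in
theorem norm_charFun_le_exp_near_zero {D : Measure ℝ} [IsProbabilityMeasure D]
    (hmean : ∫ x, x ∂D = 0) (hsq : ∫ x, x ^ 2 ∂D = 1) :
    ∃ v : ℝ, 0 < v ∧ ∀ s : ℝ, |s| ≤ v → ‖charFun D s‖ ≤ Real.exp (-s ^ 2 / 4) := by
  have h := taylor_charFun_two (P := D) (X := fun x => x) measurable_id.aemeasurable hmean hsq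
  rw [show (fun x : ℝ => x) = id from rfl, Measure.map_id] at h
  have h4 := h.def (show (0 : ℝ) < 1 / 4 by norm_num)
  rw [Metric.eventually_nhds_iff] at h4
  obtain ⟨r, hr, hball⟩ := h4
  refine ⟨min (r / 2) 1, by positivity, fun s hs => ?_⟩
  have hs1 : |s| ≤ 1 := hs.trans (min_le_right _ _)
  have hsr : |s| < r := (hs.trans (min_le_left _ _)).trans_lt (by linarith)
  have hb := hball (y := s) (by simpa using hsr)
  rw [norm_pow, Real.norm_eq_abs, sq_abs] at hb
  have hs2 : s ^ 2 ≤ 1 := by rwa [sq_le_one_iff_abs_le_one]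
  have h1 : ‖(1 - (s : ℂ) ^ 2 / 2)‖ = 1 - s ^ 2 / 2 := by
    rw [show (1 - (s : ℂ) ^ 2 / 2) = ((1 - s ^ 2 / 2 : ℝ) : ℂ) by push_cast; ring,
      Complex.norm_real, Real.norm_of_nonneg (by linarith)]
  have h2 : ‖charFun D s‖ ≤ ‖charFun D s - (1 - (s : ℂ) ^ 2 / 2)‖ + ‖(1 - (s : ℂ) ^ 2 / 2)‖ := by
    calc ‖charFun D s‖ = ‖charFun D s - (1 - (s : ℂ) ^ 2 / 2) + (1 - (s : ℂ) ^ 2 / 2)‖ := by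
          rw [sub_add_cancel]
      _ ≤ _ := norm_add_le _ _
  have h3 := Real.add_one_le_exp (-s ^ 2 / 4)
  linarith

/-- The Gaussian function as the characteristic function of the standard Gaussian. -/
theorem exp_neg_sq_eq_integral_gaussianReal (y : ℝ) :
    ((Real.exp (-y ^ 2 / 2) : ℝ) : ℂ) =
      ∫ g, Complex.exp ((y * g : ℝ) * Complex.I) ∂(gaussianReal 0 1) := by
  have h := charFun_gaussianReal (μ := 0) (v := 1) y
  rw [charFun_apply_real] at h
  push_cast at h ⊢
  rw [h]
  congr 1
  simp
  ring

theorem integral_exp_dotProduct_mul_I {D : Measure ℝ} [IsProbabilityMeasure D] {n : ℕ}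
    (x : Fin n → ℝ) (s : ℝ) :
    ∫ b : Fin n → ℝ, Complex.exp ((s * (b ⬝ᵥ x) : ℝ) * Complex.I) ∂(Measure.pi fun _ => D) =
      ∏ j, charFun D (s * x j) := by
  simp_rw [charFun_apply_real]
  rw [← integral_fintype_prod_eq_prod]
  congr 1
  ext b
  rw [← Complex.exp_sum]
  congr 1
  simp only [dotProduct, Finset.mul_sum]
  push_cast
  rw [Finset.sum_mul]
  refine Finset.sum_congr rfl fun j _ => ?_
  ring

/-- Gaussian smoothing: writing `exp (-y² / 2)` as a characteristic function and exchanging the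
order of integration bounds a smoothed small-ball probability of `⟨b, x⟩` by a Gaussian average of
the characteristic function of `⟨b, x⟩`. -/
theorem integral_exp_neg_sq_dotProduct_le {D : Measure ℝ} [IsProbabilityMeasure D] {n : ℕ}
    (x : Fin n → ℝ) (s : ℝ) :
    ∫ b : Fin n → ℝ, Real.exp (-(s * (b ⬝ᵥ x)) ^ 2 / 2) ∂(Measure.pi fun _ => D) ≤
      ∫ g, ∏ j, ‖charFun D (g * s * x j)‖ ∂(gaussianReal 0 1) := by
  have hI : Integrable (Function.uncurry fun (b : Fin n → ℝ) (g : ℝ) =>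
      Complex.exp ((s * (b ⬝ᵥ x) * g : ℝ) * Complex.I))
      ((Measure.pi fun _ => D).prod (gaussianReal 0 1)) := by
    refine (integrable_const (1 : ℝ)).mono' ?_ (Filter.Eventually.of_forall fun p => ?_)
    · apply Measurable.aestronglyMeasurable
      have := measurable_dotProduct_left x
      unfold Function.uncurry
      fun_prop
    · simp only [Function.uncurry]
      rw [Complex.norm_exp_ofReal_mul_I]
  have heq : ((∫ b : Fin n → ℝ, Real.exp (-(s * (b ⬝ᵥ x)) ^ 2 / 2) ∂(Measure.pi fun _ => D) : ℝ) :
      ℂ) = ∫ g, ∏ j, charFun D (g * s * x j) ∂(gaussianReal 0 1) := by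
    rw [← integral_complex_ofReal]
    simp_rw [exp_neg_sq_eq_integral_gaussianReal]
    rw [integral_integral_swap hI]
    congr 1
    ext g
    rw [← integral_exp_dotProduct_mul_I]
    congr 1
    ext b
    congr 3
    ring
  have hnn : 0 ≤ ∫ b : Fin n → ℝ, Real.exp (-(s * (b ⬝ᵥ x)) ^ 2 / 2) ∂(Measure.pi fun _ => D) :=
    integral_nonneg fun b => (Real.exp_pos _).le
  rw [← Real.norm_of_nonneg hnn, ← Complex.norm_real, heq]
  refine (norm_integral_le_integral_norm _).trans (le_of_eq ?_)
  simp_rw [norm_prod]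

theorem integral_exp_neg_div_gaussianReal_le {t : ℝ} (ht : 0 < t) :
    ∫ g, Real.exp (-(g / t) ^ 2 / 4) ∂(gaussianReal 0 1) ≤ 2 * t := by
  have hf : ∀ g : ℝ, Real.exp (-(g / t) ^ 2 / 4) = Real.exp (-(1 / (4 * t ^ 2)) * g ^ 2) := by
    intro g; congr 1; field_simp
  have hb : 0 < 1 / (4 * t ^ 2) := by positivity
  simp_rw [hf]
  rw [integral_gaussianReal_eq_integral_smul (by norm_num)]
  have hpdf : ∀ g : ℝ, gaussianPDFReal 0 1 g ≤ (Real.sqrt (2 * Real.pi))⁻¹ := by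
    intro g
    rw [gaussianPDFReal]
    have : Real.exp (-(g - 0) ^ 2 / (2 * ((1 : NNReal) : ℝ))) ≤ 1 := by
      rw [Real.exp_le_one_iff]
      have := sq_nonneg (g - 0)
      simp only [NNReal.coe_one]
      linarith
    have h0 : 0 ≤ (Real.sqrt (2 * Real.pi * ((1 : NNReal) : ℝ)))⁻¹ := by positivity
    simpa using mul_le_mul_of_nonneg_left this h0
  have hI := (integrable_exp_neg_mul_sq hb)
  have hI' : Integrable (fun g : ℝ =>
      gaussianPDFReal 0 1 g • Real.exp (-(1 / (4 * t ^ 2)) * g ^ 2)) := by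
    refine (hI.const_mul (Real.sqrt (2 * Real.pi))⁻¹).mono' ?_
      (Filter.Eventually.of_forall fun g => ?_)
    · have := measurable_gaussianPDFReal 0 1
      exact Measurable.aestronglyMeasurable (by fun_prop)
    · have h0 := gaussianPDFReal_nonneg 0 1 g
      rw [smul_eq_mul, Real.norm_of_nonneg (by positivity)]
      exact mul_le_mul_of_nonneg_right (hpdf g) (Real.exp_pos _).le
  calc ∫ g, gaussianPDFReal 0 1 g • Real.exp (-(1 / (4 * t ^ 2)) * g ^ 2)
      ≤ ∫ g : ℝ, (Real.sqrt (2 * Real.pi))⁻¹ * Real.exp (-(1 / (4 * t ^ 2)) * g ^ 2) :=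
        integral_mono hI' (hI.const_mul _) fun g =>
          mul_le_mul_of_nonneg_right (hpdf g) (Real.exp_pos _).le
    _ = (Real.sqrt (2 * Real.pi))⁻¹ * Real.sqrt (Real.pi / (1 / (4 * t ^ 2))) := by
        rw [integral_const_mul, integral_gaussian]
    _ ≤ 2 * t := by
        have hpi := Real.pi_pos
        rw [inv_mul_le_iff₀ (by positivity)]
        apply Real.sqrt_le_iff.2 ⟨by positivity, ?_⟩
        rw [mul_pow, Real.sq_sqrt (by positivity)]
        field_simp
        nlinarith

/-- Small-ball estimate for flat vectors. For `|g| ≤ v t / μ` the bound on the characteristic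
function of `D` near zero applies to every factor `φ (g xⱼ / t)`; larger `g` contribute at most
`(μ / (v t))²` by Chebyshev's inequality. -/
theorem measureReal_abs_dotProduct_lt_le {D : Measure ℝ} [IsProbabilityMeasure D] {v : ℝ}
    (hv : 0 < v) (hchar : ∀ s : ℝ, |s| ≤ v → ‖charFun D s‖ ≤ Real.exp (-s ^ 2 / 4))
    {t μ : ℝ} (ht : 0 < t) (hμ : 0 < μ) {n : ℕ} {x : EuclideanSpace ℝ (Fin n)}
    (hx : ‖x‖ = 1) (hflat : IsFlat μ x) :
    (Measure.pi fun _ : Fin n => D).real {b | |b ⬝ᵥ x.ofLp| < t} ≤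
      2 * (2 * t + (μ / (v * t)) ^ 2) := by
  set P := Measure.pi fun _ : Fin n => D with hP
  have hcoord : ∀ j, |x j| ≤ μ := fun j => by
    have h1 := norm_le_pi_norm x.ofLp j
    have h2 : ‖x.ofLp‖ ≤ μ * ‖x‖ := hflat
    rw [hx, mul_one] at h2
    exact h1.trans h2
  have hprod : ∀ g : ℝ, ∏ j, ‖charFun D (g * t⁻¹ * x j)‖ ≤
      Real.exp (-(g / t) ^ 2 / 4) + (μ / (v * t)) ^ 2 * g ^ 2 := by
    intro g
    rcases le_or_gt (|g| * μ) (v * t) with hg | hg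
    · refine le_add_of_le_of_nonneg ?_ (by positivity)
      calc ∏ j, ‖charFun D (g * t⁻¹ * x j)‖
          ≤ ∏ j, Real.exp (-(g * t⁻¹ * x j) ^ 2 / 4) := by
            refine Finset.prod_le_prod (fun j _ => norm_nonneg _) fun j _ => hchar _ ?_
            rw [abs_mul, abs_mul, abs_of_pos (inv_pos.2 ht)]
            calc |g| * t⁻¹ * |x j| ≤ |g| * t⁻¹ * μ := by gcongr; exact hcoord j
              _ = (|g| * μ) / t := by ring
              _ ≤ v := by rwa [div_le_iff₀ ht]
        _ = Real.exp (-(g / t) ^ 2 / 4) := by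
            rw [← Real.exp_sum]
            congr 1
            have h1 : ∀ j, -(g * t⁻¹ * x j) ^ 2 / 4 = -(g / t) ^ 2 / 4 * x j ^ 2 := fun j => by
              ring
            simp_rw [h1]
            rw [← Finset.mul_sum, ← EuclideanSpace.real_norm_sq_eq, hx]
            ring
    · have h1 : ∏ j, ‖charFun D (g * t⁻¹ * x j)‖ ≤ 1 :=
        Finset.prod_le_one (fun j _ => norm_nonneg _) fun j _ => norm_charFun_le_one _
      have h2 : 1 ≤ (μ / (v * t)) ^ 2 * g ^ 2 := by
        rw [← sq_abs g, ← mul_pow]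
        apply one_le_pow₀
        rw [div_mul_eq_mul_div, one_le_div (by positivity)]
        linarith
      have h3 := Real.exp_pos (-(g / t) ^ 2 / 4)
      linarith
  have hIe : Integrable (fun g : ℝ => Real.exp (-(g / t) ^ 2 / 4)) (gaussianReal 0 1) := by
    refine (integrable_const (1 : ℝ)).mono' (by fun_prop) (Filter.Eventually.of_forall fun g => ?_)
    rw [Real.norm_of_nonneg (Real.exp_pos _).le, Real.exp_le_one_iff]
    have := sq_nonneg (g / t)
    linarith
  have hg2 : ∫ g, g ^ 2 ∂(gaussianReal 0 1) = 1 := by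
    have h1 := variance_id_gaussianReal (μ := 0) (v := 1)
    rw [variance_of_integral_eq_zero (by fun_prop) (by simp)] at h1
    simpa using h1
  have hIg : Integrable (fun g : ℝ => g ^ 2) (gaussianReal 0 1) :=
    .of_integral_ne_zero (by rw [hg2]; norm_num)
  have hIp : Integrable (fun g : ℝ => ∏ j, ‖charFun D (g * t⁻¹ * x j)‖) (gaussianReal 0 1) := by
    refine (integrable_const (1 : ℝ)).mono' ?_ (Filter.Eventually.of_forall fun g => ?_)
    · have := measurable_charFun (μ := D)
      exact Measurable.aestronglyMeasurable (by fun_prop)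
    · rw [Real.norm_of_nonneg (Finset.prod_nonneg fun j _ => norm_nonneg _)]
      exact Finset.prod_le_one (fun j _ => norm_nonneg _) fun j _ => norm_charFun_le_one _
  have hmain : ∫ b : Fin n → ℝ, Real.exp (-(t⁻¹ * (b ⬝ᵥ x.ofLp)) ^ 2 / 2) ∂P ≤
      2 * t + (μ / (v * t)) ^ 2 := by
    calc _ ≤ ∫ g, ∏ j, ‖charFun D (g * t⁻¹ * x j)‖ ∂(gaussianReal 0 1) :=
          integral_exp_neg_sq_dotProduct_le _ _
      _ ≤ ∫ g, (Real.exp (-(g / t) ^ 2 / 4) + (μ / (v * t)) ^ 2 * g ^ 2) ∂(gaussianReal 0 1) :=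
          integral_mono hIp (hIe.add (hIg.const_mul _)) hprod
      _ = ∫ g, Real.exp (-(g / t) ^ 2 / 4) ∂(gaussianReal 0 1) + (μ / (v * t)) ^ 2 := by
          rw [integral_add hIe (hIg.const_mul _), integral_const_mul, hg2, mul_one]
      _ ≤ _ := by
          have := integral_exp_neg_div_gaussianReal_le ht
          linarith
  have hmeas := measurable_dotProduct_left x.ofLp
  have hAm : MeasurableSet {b : Fin n → ℝ | |b ⬝ᵥ x.ofLp| < t} :=
    measurableSet_lt hmeas.norm measurable_const
  have hIS : Integrable (fun b : Fin n → ℝ => Real.exp (-(t⁻¹ * (b ⬝ᵥ x.ofLp)) ^ 2 / 2)) P := by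
    refine (integrable_const (1 : ℝ)).mono' (Measurable.aestronglyMeasurable (by fun_prop))
      (Filter.Eventually.of_forall fun b => ?_)
    rw [Real.norm_of_nonneg (Real.exp_pos _).le, Real.exp_le_one_iff]
    have := sq_nonneg (t⁻¹ * (b ⬝ᵥ x.ofLp))
    linarith
  -- On `|⟨b, x⟩| < t` the Gaussian is at least `exp (-1 / 2) ≥ 1 / 2`.
  have hmarkov : P.real {b : Fin n → ℝ | |b ⬝ᵥ x.ofLp| < t} ≤
      ∫ b : Fin n → ℝ, 2 * Real.exp (-(t⁻¹ * (b ⬝ᵥ x.ofLp)) ^ 2 / 2) ∂P := by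
    rw [← integral_indicator_one hAm]
    refine integral_mono ((integrable_const (1 : ℝ)).indicator hAm) (hIS.const_mul 2) fun b => ?_
    by_cases hb : b ∈ {b : Fin n → ℝ | |b ⬝ᵥ x.ofLp| < t}
    · rw [Set.indicator_of_mem hb]
      have h1 : (t⁻¹ * (b ⬝ᵥ x.ofLp)) ^ 2 ≤ 1 := by
        rw [sq_le_one_iff_abs_le_one, abs_mul, abs_of_pos (inv_pos.2 ht), inv_mul_le_iff₀ ht,
          mul_one]
        exact le_of_lt hb
      have h2 := Real.add_one_le_exp (-(t⁻¹ * (b ⬝ᵥ x.ofLp)) ^ 2 / 2)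
      simp only [Pi.one_apply]
      linarith
    · rw [Set.indicator_of_notMem hb]
      positivity
  rw [integral_const_mul] at hmarkov
  linarith

/-- The set of vectors `b` that are `t`-large on the pair `(y, y₀)`: both `⟨b, y⟩` and `⟨b, y₀⟩` are
at least `t` in absolute value. -/
def largePair {n : ℕ} (t : ℝ) (y y₀ : EuclideanSpace ℝ (Fin n)) : Set (Fin n → ℝ) :=
  {b | t ≤ |b ⬝ᵥ y.ofLp| ∧ t ≤ |b ⬝ᵥ y₀.ofLp|}

theorem measurableSet_largePair {n : ℕ} (t : ℝ) (y y₀ : EuclideanSpace ℝ (Fin n)) :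
    MeasurableSet (largePair t y y₀) :=
  (measurableSet_le measurable_const (measurable_dotProduct_left _).norm).inter
    (measurableSet_le measurable_const (measurable_dotProduct_left _).norm)

/-- Joint small-ball estimate: the two marginals along a unit vector and a flat unit vector are
simultaneously bounded away from zero with probability bounded below. -/
theorem IsSubgaussian.exists_joint_smallBall {D : Measure ℝ} [IsProbabilityMeasure D]
    (hD : IsSubgaussian D) (hmean : ∫ x, x ∂D = 0)
    (hvar : variance (fun x : ℝ => x) D = 1) :
    ∃ μ t q : ℝ, 0 < μ ∧ μ < 1 ∧ 0 < t ∧ 0 < q ∧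
      ∀ (n : ℕ) (x x₀ : EuclideanSpace ℝ (Fin n)), ‖x‖ = 1 → ‖x₀‖ = 1 → IsFlat μ x₀ →
        q ≤ (Measure.pi fun _ : Fin n => D).real (largePair t x x₀) := by
  obtain ⟨l, hl, hexp⟩ := hD.exists_integral_exp_dotProduct_sq_le hmean
  obtain ⟨K, hK0, hK⟩ := hD.exists_hasSubgaussianMGF hmean
  have hL2 : MemLp (fun x : ℝ => x) 2 D := hK.memLp 2
  have hsq : ∫ x, x ^ 2 ∂D = 1 := by
    rw [← hvar, variance_of_integral_eq_zero (by fun_prop) hmean]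
  obtain ⟨v, hv, hchar⟩ := norm_charFun_le_exp_near_zero hmean hsq
  set q : ℝ := min (l ^ 2 / 80) 1 with hq
  have hq0 : 0 < q := by positivity
  have hq1 : q ≤ 1 := min_le_right _ _
  -- With these `t` and `μ` the small-ball probability `2 (2 t + (μ / (v t))²)` is at most
  -- `3 q / 8`.
  set t : ℝ := q / 16 with ht
  have ht0 : 0 < t := by positivity
  set μ : ℝ := min (1 / 2) (v * t * (q / 4)) with hμ
  have hμ0 : 0 < μ := by positivity
  refine ⟨μ, t, q / 4, hμ0, (min_le_left _ _).trans_lt (by norm_num), ht0, by positivity,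
    fun n x x₀ hx hx₀ hflat => ?_⟩
  set P := Measure.pi fun _ : Fin n => D with hP
  have h1 : q ≤ P.real {b | 1 / 2 ≤ (b ⬝ᵥ x.ofLp) ^ 2} := by
    refine (min_le_left _ _).trans (le_measureReal_half_le_sq (measurable_dotProduct_left _) hl
      (hexp n x hx).1 (hexp n x hx).2 ?_)
    rw [integral_dotProduct_sq hL2 hmean hvar, hx, one_pow]
  have h2 := measureReal_abs_dotProduct_lt_le hv hchar ht0 hμ0 hx₀ hflat
  have h3 : μ / (v * t) ≤ q / 4 := by
    rw [div_le_iff₀ (by positivity)]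
    exact (min_le_right _ _).trans (le_of_eq (by ring))
  have h4 : (μ / (v * t)) ^ 2 ≤ q / 16 := by
    calc (μ / (v * t)) ^ 2 ≤ (q / 4) ^ 2 := by gcongr
      _ ≤ q / 16 := by nlinarith
  have hsub : {b : Fin n → ℝ | 1 / 2 ≤ (b ⬝ᵥ x.ofLp) ^ 2} ⊆
      largePair t x x₀ ∪ {b | |b ⬝ᵥ x₀.ofLp| < t} := by
    intro b hb
    have hb' : 1 / 2 ≤ (b ⬝ᵥ x.ofLp) ^ 2 := hb
    rcases lt_or_ge |b ⬝ᵥ x₀.ofLp| t with h | h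
    · exact Or.inr h
    · refine Or.inl ⟨?_, h⟩
      by_contra! hlt
      have h6 := abs_nonneg (b ⬝ᵥ x.ofLp)
      rw [← sq_abs] at hb'
      nlinarith
  have h5 := (measureReal_mono hsub).trans (measureReal_union_le (μ := P) _ _)
  linarith

/-! ### Chernoff bounds and nets -/

/-- Chernoff bound for a sum of independent copies of `f`. -/
theorem measureReal_pi_le_sum_le {Ω : Type*} [MeasurableSpace Ω] {ν : Measure Ω}
    [IsProbabilityMeasure ν] {f : Ω → ℝ} {C B : ℝ}
    (hint : Integrable (fun ω => Real.exp (f ω)) ν)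
    (hle : ∫ ω, Real.exp (f ω) ∂ν ≤ C) (m : ℕ) :
    (Measure.pi fun _ : Fin m => ν).real {a | B * m ≤ ∑ i, f (a i)} ≤
      (C * Real.exp (-B)) ^ m := by
  have hI : Integrable (fun a : Fin m → Ω => ∏ i, Real.exp (f (a i)))
      (Measure.pi fun _ => ν) :=
    Integrable.fintype_prod (f := fun _ ω => Real.exp (f ω)) fun _ => hint
  have hmarkov := mul_meas_ge_le_integral_of_nonneg (μ := Measure.pi fun _ : Fin m => ν)
    (Filter.Eventually.of_forall fun a => Finset.prod_nonneg fun i _ => (Real.exp_pos (f (a i))).le)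
    hI (Real.exp (B * m))
  have hset : {a : Fin m → Ω | Real.exp (B * m) ≤ ∏ i, Real.exp (f (a i))} =
      {a | B * m ≤ ∑ i, f (a i)} := by
    ext a
    change Real.exp (B * m) ≤ ∏ i, Real.exp (f (a i)) ↔ B * m ≤ ∑ i, f (a i)
    rw [← Real.exp_sum, Real.exp_le_exp]
  rw [hset, integral_fintype_prod_eq_pow (fun ω => Real.exp (f ω)), Fintype.card_fin] at hmarkov
  have hpow : (∫ ω, Real.exp (f ω) ∂ν) ^ m ≤ C ^ m :=
    pow_le_pow_left₀ (integral_nonneg fun ω => (Real.exp_pos _).le) hle m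
  have hB : Real.exp (-B) ^ m * Real.exp (B * m) = 1 := by
    rw [← Real.exp_nat_mul, ← Real.exp_add, Real.exp_eq_one_iff]
    ring
  calc _ = Real.exp (-B) ^ m * (Real.exp (B * m) *
        (Measure.pi fun _ : Fin m => ν).real {a | B * m ≤ ∑ i, f (a i)}) := by
        rw [← mul_assoc, hB, one_mul]
    _ ≤ Real.exp (-B) ^ m * C ^ m := by
        gcongr
        exact hmarkov.trans hpow
    _ = _ := by rw [mul_pow, mul_comm]

/-- Lower-tail Chernoff bound: among `m` independent points, at least `q m / 4` fall into a set of
probability at least `q`, up to an exponentially small probability. -/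
theorem measureReal_pi_sum_indicator_le {Ω : Type*} [MeasurableSpace Ω] {ν : Measure Ω}
    [IsProbabilityMeasure ν] {A : Set Ω} (hA : MeasurableSet A) {q : ℝ} (hq : q ≤ ν.real A)
    (m : ℕ) :
    (Measure.pi fun _ : Fin m => ν).real {a | ∑ i, A.indicator (fun _ => (1 : ℝ)) (a i) ≤ q / 4 * m}
      ≤ Real.exp (-(q / 4)) ^ m := by
  have hexp : ∀ ω, Real.exp (-A.indicator (fun _ => (1 : ℝ)) ω) =
      1 + A.indicator (fun _ => Real.exp (-1) - 1) ω := by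
    intro ω
    by_cases hω : ω ∈ A <;> simp [hω]
  have hI : Integrable (A.indicator fun _ => Real.exp (-1) - 1) ν :=
    (integrable_const _).indicator hA
  have hint : Integrable (fun ω => Real.exp (-A.indicator (fun _ => (1 : ℝ)) ω)) ν := by
    simp_rw [hexp]
    exact (integrable_const _).add hI
  have hle : ∫ ω, Real.exp (-A.indicator (fun _ => (1 : ℝ)) ω) ∂ν ≤ Real.exp (-(q / 2)) := by
    simp_rw [hexp]
    rw [integral_add (integrable_const _) hI, integral_indicator_const _ hA]
    simp only [integral_const, probReal_univ, smul_eq_mul, one_mul]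
    have h1 : Real.exp (-1) ≤ 1 / 2 := by
      rw [Real.exp_neg, inv_le_comm₀ (Real.exp_pos _) (by norm_num)]
      have := Real.add_one_le_exp (1 : ℝ)
      norm_num at this ⊢
      exact this
    have h2 := Real.add_one_le_exp (-(q / 2))
    have h3 : 0 ≤ ν.real A := measureReal_nonneg
    nlinarith
  -- Apply the upper-tail bound to minus the indicator.
  have h := measureReal_pi_le_sum_le (B := -(q / 4)) hint hle m
  rw [← Real.exp_add] at h
  refine le_trans (le_of_eq ?_) (h.trans (le_of_eq ?_))
  · congr 1
    ext a
    change ∑ i, A.indicator (fun _ => (1 : ℝ)) (a i) ≤ q / 4 * m ↔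
      -(q / 4) * m ≤ ∑ i, -A.indicator (fun _ => (1 : ℝ)) (a i)
    rw [Finset.sum_neg_distrib]
    constructor <;> intro h <;> linarith
  · congr 2
    ring

open Metric in
/-- Volumetric bound on separated subsets of the unit ball: the balls of radius `ε / 2` around the
points are disjoint and lie in the ball of radius `3 / 2`. -/
theorem card_le_of_separated_of_norm_le_one {E : Type*} [NormedAddCommGroup E] [NormedSpace ℝ E]
    [FiniteDimensional ℝ E] {ε : ℝ} (hε : 0 < ε) (hε1 : ε ≤ 1) (s : Finset E)
    (hs : ∀ c ∈ s, ‖c‖ ≤ 1) (h : ∀ c ∈ s, ∀ d ∈ s, c ≠ d → ε ≤ ‖c - d‖) :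
    (s.card : ℝ) ≤ (3 / ε) ^ Module.finrank ℝ E := by
  borelize E
  let ν : Measure E := Measure.addHaar
  have hdisj : (s : Set E).PairwiseDisjoint fun c => ball c (ε / 2) := by
    intro c hc d hd hcd
    apply ball_disjoint_ball
    rw [dist_eq_norm]
    linarith [h c hc d hd hcd]
  have hsub : ⋃ c ∈ s, ball c (ε / 2) ⊆ ball (0 : E) (3 / 2) := by
    refine Set.iUnion₂_subset fun c hc => ball_subset_ball' ?_
    rw [dist_zero_right]
    linarith [hs c hc]
  have hvol := measure_mono (μ := ν) hsub
  rw [measure_biUnion_finset hdisj fun c _ => measurableSet_ball] at hvol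
  simp_rw [Measure.addHaar_ball_of_pos ν _ (half_pos hε),
    Measure.addHaar_ball_of_pos ν (0 : E) (show (0 : ℝ) < 3 / 2 by norm_num)] at hvol
  rw [Finset.sum_const, nsmul_eq_mul, ← mul_assoc] at hvol
  have hpos : ν (ball 0 1) ≠ 0 := (measure_ball_pos _ _ one_pos).ne'
  have hfin : ν (ball 0 1) ≠ ⊤ := measure_ball_lt_top.ne
  rw [ENNReal.mul_le_mul_iff_left hpos hfin, ← ENNReal.ofReal_natCast,
    ← ENNReal.ofReal_mul (by positivity), ENNReal.ofReal_le_ofReal_iff (by positivity)] at hvol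
  have he : (3 / ε) ^ Module.finrank ℝ E * (ε / 2) ^ Module.finrank ℝ E =
      (3 / 2 : ℝ) ^ Module.finrank ℝ E := by
    rw [← mul_pow]; congr 1; field_simp
  rw [← he] at hvol
  exact le_of_mul_le_mul_right hvol (by positivity)

/-- Any subset of the unit ball has an `ε`-net of at most `(3 / ε) ^ dim` of its own points,
namely a maximal `ε`-separated subset. That the net lies in the set matters for the set of flat
vectors. -/
theorem exists_finset_net {E : Type*} [NormedAddCommGroup E] [NormedSpace ℝ E]
    [FiniteDimensional ℝ E] {ε : ℝ} (hε : 0 < ε) (hε1 : ε ≤ 1) {S : Set E}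
    (hS : ∀ x ∈ S, ‖x‖ ≤ 1) :
    ∃ N : Finset E, ↑N ⊆ S ∧ (N.card : ℝ) ≤ (3 / ε) ^ Module.finrank ℝ E ∧
      ∀ x ∈ S, ∃ y ∈ N, ‖x - y‖ ≤ ε := by
  classical
  set Q : ℕ → Prop := fun k => ∃ N : Finset E, ↑N ⊆ S ∧
    (∀ c ∈ N, ∀ d ∈ N, c ≠ d → ε ≤ ‖c - d‖) ∧ N.card = k with hQ
  have hcard : ∀ N : Finset E, ↑N ⊆ S → (∀ c ∈ N, ∀ d ∈ N, c ≠ d → ε ≤ ‖c - d‖) →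
      (N.card : ℝ) ≤ (3 / ε) ^ Module.finrank ℝ E := fun N hN hsep =>
    card_le_of_separated_of_norm_le_one hε hε1 N (fun c hc => hS c (hN hc)) hsep
  have hbdd : ∀ k, Q k → k ≤ ⌊(3 / ε) ^ Module.finrank ℝ E⌋₊ := by
    rintro k ⟨N, hN, hsep, rfl⟩
    exact Nat.le_floor (hcard N hN hsep)
  have hQ0 : Q 0 := ⟨∅, by simp⟩
  obtain ⟨N, hN, hsep, hNcard⟩ := Nat.findGreatest_spec (P := Q) (Nat.zero_le _) hQ0
  refine ⟨N, hN, hcard N hN hsep, fun x hx => ?_⟩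
  by_contra! hfar
  have hxN : x ∉ N := fun hmem => by
    have := hfar x hmem
    rw [sub_self, norm_zero] at this
    linarith
  have hQ1 : Q (N.card + 1) := by
    refine ⟨insert x N, ?_, ?_, Finset.card_insert_of_notMem hxN⟩
    · rw [Finset.coe_insert]
      exact Set.insert_subset hx hN
    · intro c hc d hd hcd
      rcases Finset.mem_insert.1 hc with hc' | hc' <;> rcases Finset.mem_insert.1 hd with hd' | hd'
      · exact absurd (hc'.trans hd'.symm) hcd
      · exact hc' ▸ (hfar d hd').le
      · rw [norm_sub_rev]
        exact hd' ▸ (hfar c hc').le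
      · exact hsep c hc' d hd' hcd
  have := Nat.le_findGreatest (hbdd _ hQ1) hQ1
  rw [← hNcard] at this
  omega

/-! ### From nets to all vectors -/

/-- A quadratic bound on a net of the unit sphere of mesh at most `1 / 2` extends to all vectors
with the loss of a factor `4`. -/
theorem sum_dotProduct_sq_le_of_net {m n : ℕ} (a : Fin m → Fin n → ℝ) {M ε : ℝ} (hM : 0 ≤ M)
    (hε : ε ≤ 1 / 2) {N : Finset (EuclideanSpace ℝ (Fin n))}
    (hN : ∀ x : EuclideanSpace ℝ (Fin n), ‖x‖ = 1 → ∃ y ∈ N, ‖x - y‖ ≤ ε)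
    (hle : ∀ y ∈ N, ∑ i, (a i ⬝ᵥ y.ofLp) ^ 2 ≤ M) (z : EuclideanSpace ℝ (Fin n)) :
    ∑ i, (a i ⬝ᵥ z.ofLp) ^ 2 ≤ 4 * M * ‖z‖ ^ 2 := by
  set T : EuclideanSpace ℝ (Fin n) →L[ℝ] EuclideanSpace ℝ (Fin m) :=
    LinearMap.toContinuousLinearMap (Matrix.toLpLin 2 2 (Matrix.of a)) with hT
  have hnorm : ∀ z : EuclideanSpace ℝ (Fin n), ‖T z‖ ^ 2 = ∑ i, (a i ⬝ᵥ z.ofLp) ^ 2 := by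
    intro z
    rw [EuclideanSpace.real_norm_sq_eq]
    rfl
  -- The bound on the net gives a self-improving inequality for the operator norm.
  have hself : ‖T‖ ≤ Real.sqrt M + ‖T‖ * (1 / 2) := by
    refine ContinuousLinearMap.opNorm_le_of_unit_norm (by positivity) fun x hx => ?_
    obtain ⟨y, hy, hxy⟩ := hN x hx
    have h1 : ‖T y‖ ≤ Real.sqrt M := Real.le_sqrt_of_sq_le ((hnorm y).trans_le (hle y hy))
    have h2 : ‖T (x - y)‖ ≤ ‖T‖ * (1 / 2) :=
      (T.le_opNorm _).trans (by gcongr; exact hxy.trans hε)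
    calc ‖T x‖ = ‖T y + T (x - y)‖ := by rw [← map_add, add_sub_cancel]
      _ ≤ ‖T y‖ + ‖T (x - y)‖ := norm_add_le _ _
      _ ≤ _ := add_le_add h1 h2
  have hop : ‖T‖ ≤ 2 * Real.sqrt M := by linarith
  rw [← hnorm]
  calc ‖T z‖ ^ 2 ≤ (2 * Real.sqrt M * ‖z‖) ^ 2 := by
        gcongr
        exact (T.le_opNorm z).trans (by gcongr)
    _ = 4 * M * ‖z‖ ^ 2 := by rw [mul_pow, mul_pow, Real.sq_sqrt hM]; ring

theorem abs_mul_abs_ge_of_close {t X X₀ Y Y₀ : ℝ} (ht : 0 < t) (hY : t ≤ |Y|) (hY₀ : t ≤ |Y₀|) :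
    t ^ 2 / 4 - (X - Y) ^ 2 - (X₀ - Y₀) ^ 2 ≤ |X| * |X₀| := by
  have hprod : 0 ≤ |X| * |X₀| := by positivity
  by_cases h : t / 2 ≤ |X - Y|
  · have h1 : (t / 2) ^ 2 ≤ (X - Y) ^ 2 := by rw [← sq_abs (X - Y)]; gcongr
    nlinarith [sq_nonneg (X₀ - Y₀)]
  by_cases h₀ : t / 2 ≤ |X₀ - Y₀|
  · have h1 : (t / 2) ^ 2 ≤ (X₀ - Y₀) ^ 2 := by rw [← sq_abs (X₀ - Y₀)]; gcongr
    nlinarith [sq_nonneg (X - Y)]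
  · have h1 : t / 2 ≤ |X| := by
      have := abs_sub_abs_le_abs_sub Y X
      rw [abs_sub_comm] at this
      linarith
    have h2 : t / 2 ≤ |X₀| := by
      have := abs_sub_abs_le_abs_sub Y₀ X₀
      rw [abs_sub_comm] at this
      linarith
    nlinarith [sq_nonneg (X - Y), sq_nonneg (X₀ - Y₀), mul_le_mul h1 h2 (by positivity)
      (abs_nonneg X)]

/-- If a proportion `q / 4` of the `aᵢ` is large on a pair `(y, y₀)`, then the sum of products is
bounded below at every nearby pair `(x, x₀)`. -/
theorem sum_abs_mul_abs_ge_of_close {m n : ℕ} (a : Fin m → Fin n → ℝ) {t q B ε : ℝ}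
    (ht : 0 < t) (hB : 0 ≤ B) (hsmall : 256 * B * ε ^ 2 ≤ q * t ^ 2)
    (hop : ∀ z : EuclideanSpace ℝ (Fin n), ∑ i, (a i ⬝ᵥ z.ofLp) ^ 2 ≤ 4 * (B * m) * ‖z‖ ^ 2)
    {x x₀ y y₀ : EuclideanSpace ℝ (Fin n)} (hxy : ‖x - y‖ ≤ ε) (hxy₀ : ‖x₀ - y₀‖ ≤ ε)
    (hcount : q / 4 * m ≤ ∑ i, (largePair t y y₀).indicator
      (fun _ => (1 : ℝ)) (a i)) :
    q * t ^ 2 / 32 * m ≤ ∑ i, |a i ⬝ᵥ x.ofLp| * |a i ⬝ᵥ x₀.ofLp| := by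
  have hpt : ∀ i, t ^ 2 / 4 * (largePair t y y₀).indicator (fun _ => (1 : ℝ)) (a i) -
      (a i ⬝ᵥ (x - y).ofLp) ^ 2 - (a i ⬝ᵥ (x₀ - y₀).ofLp) ^ 2 ≤
      |a i ⬝ᵥ x.ofLp| * |a i ⬝ᵥ x₀.ofLp| := by
    intro i
    by_cases hi : a i ∈ largePair t y y₀
    · have hi' : t ≤ |a i ⬝ᵥ y.ofLp| ∧ t ≤ |a i ⬝ᵥ y₀.ofLp| := hi
      rw [Set.indicator_of_mem hi, mul_one, WithLp.ofLp_sub, WithLp.ofLp_sub, dotProduct_sub,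
        dotProduct_sub]
      exact abs_mul_abs_ge_of_close ht hi'.1 hi'.2
    · rw [Set.indicator_of_notMem hi]
      have : 0 ≤ |a i ⬝ᵥ x.ofLp| * |a i ⬝ᵥ x₀.ofLp| := by positivity
      nlinarith [sq_nonneg (a i ⬝ᵥ (x - y).ofLp), sq_nonneg (a i ⬝ᵥ (x₀ - y₀).ofLp)]
  have hsum := Finset.sum_le_sum fun i (_ : i ∈ Finset.univ) => hpt i
  rw [Finset.sum_sub_distrib, Finset.sum_sub_distrib, ← Finset.mul_sum] at hsum
  have hbound : ∀ w : EuclideanSpace ℝ (Fin n), ‖w‖ ≤ ε →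
      ∑ i, (a i ⬝ᵥ w.ofLp) ^ 2 ≤ q * t ^ 2 / 64 * m := by
    intro w hw
    calc _ ≤ 4 * (B * m) * ‖w‖ ^ 2 := hop w
      _ ≤ 4 * (B * m) * ε ^ 2 := by gcongr
      _ = (256 * B * ε ^ 2) / 64 * m := by ring
      _ ≤ _ := by gcongr
  have h1 := hbound _ hxy
  have h2 := hbound _ hxy₀
  have h3 := mul_le_mul_of_nonneg_left hcount (show 0 ≤ t ^ 2 / 4 by positivity)
  linarith

/-! ### The tangent space -/

theorem samplingOperator_tangent {m n : ℕ} (a : Fin m → Fin n → ℝ) (x x₀ : Fin n → ℝ) (i : Fin m) :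
    samplingOperator a (Matrix.vecMulVec x x₀ + Matrix.vecMulVec x₀ x) i =
      2 * ((a i ⬝ᵥ x) * (a i ⬝ᵥ x₀)) := by
  simp only [samplingOperator, Matrix.mul_add, Matrix.trace_add, Matrix.vecMulVec_mul_vecMulVec,
    Matrix.trace_vecMulVec, dotProduct_smul, smul_eq_mul]
  ring

theorem operatorNorm_vecMulVec_le {n : ℕ} (x y : EuclideanSpace ℝ (Fin n)) :
    ‖Matrix.toEuclideanCLM (n := Fin n) (𝕜 := ℝ) (Matrix.vecMulVec x.ofLp y.ofLp)‖ ≤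
      ‖x‖ * ‖y‖ := by
  refine ContinuousLinearMap.opNorm_le_bound _ (by positivity) fun z => ?_
  have h : Matrix.toEuclideanCLM (n := Fin n) (𝕜 := ℝ) (Matrix.vecMulVec x.ofLp y.ofLp) z =
      (inner ℝ y z) • x := by
    ext i
    simp [Matrix.vecMulVec_mulVec, EuclideanSpace.inner_eq_star_dotProduct, dotProduct_comm,
      mul_comm]
  rw [h, norm_smul]
  calc _ ≤ ‖y‖ * ‖z‖ * ‖x‖ := by gcongr; exact norm_inner_le_norm _ _
    _ = _ := by ring

theorem operatorNorm_tangent_le {n : ℕ} (x x₀ : EuclideanSpace ℝ (Fin n)) :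
    operatorNorm (Matrix.vecMulVec x.ofLp x₀.ofLp + Matrix.vecMulVec x₀.ofLp x.ofLp) ≤
      2 * (‖x‖ * ‖x₀‖) := by
  rw [operatorNorm, map_add]
  refine (norm_add_le _ _).trans ?_
  have h1 := operatorNorm_vecMulVec_le x x₀
  have h2 := operatorNorm_vecMulVec_le x₀ x
  linarith

theorem operatorNorm_le_l1Norm_of_unit {m n : ℕ} {a : Fin m → Fin n → ℝ} {μ β : ℝ} (hm : 0 < m)
    (hβ : 0 ≤ β)
    (hunit : ∀ x x₀ : EuclideanSpace ℝ (Fin n), ‖x‖ = 1 → ‖x₀‖ = 1 → IsFlat μ x₀ →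
      β * m ≤ ∑ i, |a i ⬝ᵥ x.ofLp| * |a i ⬝ᵥ x₀.ofLp|)
    {x₀ : EuclideanSpace ℝ (Fin n)} (hx₀ : x₀ ∈ flatVectors n μ \ {0})
    {X : Matrix (Fin n) (Fin n) ℝ} (hX : X ∈ tangentSpace x₀) :
    β * operatorNorm X ≤ 1 / (m : ℝ) * l1Norm (samplingOperator a X) := by
  obtain ⟨hflat, hne⟩ := hx₀
  have hx₀0 : 0 < ‖x₀‖ := norm_pos_iff.2 hne
  obtain ⟨x, rfl⟩ := hX
  have hm' : (0 : ℝ) < m := by exact_mod_cast hm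
  have hl1 : l1Norm (samplingOperator a (Matrix.vecMulVec x.ofLp x₀.ofLp +
      Matrix.vecMulVec x₀.ofLp x.ofLp)) = 2 * ∑ i, |a i ⬝ᵥ x.ofLp| * |a i ⬝ᵥ x₀.ofLp| := by
    rw [l1Norm, Finset.mul_sum]
    refine Finset.sum_congr rfl fun i _ => ?_
    rw [samplingOperator_tangent, abs_mul, abs_mul, abs_two]
  have hop := operatorNorm_tangent_le x x₀
  rw [hl1]
  suffices h : β * m * (‖x‖ * ‖x₀‖) ≤ ∑ i, |a i ⬝ᵥ x.ofLp| * |a i ⬝ᵥ x₀.ofLp| by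
    rw [one_div, inv_mul_eq_div, le_div_iff₀ hm']
    calc _ ≤ β * (2 * (‖x‖ * ‖x₀‖)) * m := by gcongr
      _ = 2 * (β * m * (‖x‖ * ‖x₀‖)) := by ring
      _ ≤ _ := by gcongr
  rcases eq_or_ne x 0 with rfl | hx
  · simp
  have hx0 : 0 < ‖x‖ := norm_pos_iff.2 hx
  have hflat' : IsFlat μ (‖x₀‖⁻¹ • x₀) := by
    have h1 : ‖x₀.ofLp‖ ≤ μ * ‖x₀‖ := hflat
    unfold IsFlat
    rw [WithLp.ofLp_smul, norm_smul, norm_smul, norm_inv, norm_norm, mul_left_comm]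
    gcongr
  have h := hunit (‖x‖⁻¹ • x) (‖x₀‖⁻¹ • x₀) (norm_smul_inv_norm hx) (norm_smul_inv_norm hne) hflat'
  simp only [WithLp.ofLp_smul, dotProduct_smul, smul_eq_mul, abs_mul, abs_inv, abs_norm] at h
  have hfac : ∑ i, ‖x‖⁻¹ * |a i ⬝ᵥ x.ofLp| * (‖x₀‖⁻¹ * |a i ⬝ᵥ x₀.ofLp|) =
      (∑ i, |a i ⬝ᵥ x.ofLp| * |a i ⬝ᵥ x₀.ofLp|) / (‖x‖ * ‖x₀‖) := by
    rw [Finset.sum_div]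
    refine Finset.sum_congr rfl fun i _ => ?_
    field_simp
  rw [hfac, le_div_iff₀ (by positivity)] at h
  exact h

/-! ### The union bound -/

theorem measureReal_le_sum_dotProduct_sq_le {D : Measure ℝ} [IsProbabilityMeasure D] {l : ℝ}
    (hl : 0 < l) {n : ℕ} {y : EuclideanSpace ℝ (Fin n)}
    (hint : Integrable (fun b : Fin n → ℝ => Real.exp (l * (b ⬝ᵥ y.ofLp) ^ 2))
      (Measure.pi fun _ => D))
    (hle : ∫ b : Fin n → ℝ, Real.exp (l * (b ⬝ᵥ y.ofLp) ^ 2) ∂(Measure.pi fun _ => D) ≤ 10)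
    (m : ℕ) :
    (measurementLaw D m n).real {a | 4 / l * m ≤ ∑ i, (a i ⬝ᵥ y.ofLp) ^ 2} ≤ Real.exp (-m) := by
  have h := measureReal_pi_le_sum_le (B := 4) hint hle m
  have hset : {a : Fin m → Fin n → ℝ | 4 / l * m ≤ ∑ i, (a i ⬝ᵥ y.ofLp) ^ 2} =
      {a | 4 * m ≤ ∑ i, l * (a i ⬝ᵥ y.ofLp) ^ 2} := by
    ext a
    change 4 / l * m ≤ ∑ i, (a i ⬝ᵥ y.ofLp) ^ 2 ↔ 4 * m ≤ ∑ i, l * (a i ⬝ᵥ y.ofLp) ^ 2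
    rw [← Finset.mul_sum, div_mul_eq_mul_div, div_le_iff₀' hl]
  rw [hset]
  refine h.trans ?_
  have h3 : (10 : ℝ) ≤ Real.exp 3 := by
    have h1 := Real.exp_one_gt_d9
    calc (10 : ℝ) ≤ 2.7 ^ 3 := by norm_num
      _ ≤ Real.exp 1 ^ 3 := by gcongr; linarith
      _ = Real.exp 3 := by rw [← Real.exp_nat_mul]; norm_num
  calc (10 * Real.exp (-4)) ^ m ≤ (Real.exp 3 * Real.exp (-4)) ^ m := by gcongr
    _ = Real.exp (-m) := by rw [← Real.exp_add, ← Real.exp_nat_mul]; congr 1; ring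

theorem measureReal_biUnion_le_exp {Ω ι : Type*} [MeasurableSpace Ω] (P : Measure Ω)
    {s : Finset ι} {A : ι → Set Ω} {u w : ℝ} (hs : (s.card : ℝ) ≤ Real.exp u)
    (hA : ∀ i ∈ s, P.real (A i) ≤ Real.exp (-w)) :
    P.real (⋃ i ∈ s, A i) ≤ Real.exp (u - w) := by
  refine (measureReal_biUnion_finset_le _ _).trans ((Finset.sum_le_card_nsmul _ _ _ hA).trans ?_)
  rw [nsmul_eq_mul, sub_eq_add_neg, Real.exp_add]
  gcongr

theorem sum_abs_mul_abs_ge_of_nets {m n : ℕ} {a : Fin m → Fin n → ℝ} {μ t q B ε : ℝ}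
    (ht : 0 < t) (hB : 0 ≤ B) (hε : ε ≤ 1 / 2) (hsmall : 256 * B * ε ^ 2 ≤ q * t ^ 2)
    {N N₀ : Finset (EuclideanSpace ℝ (Fin n))}
    (hN : ∀ x : EuclideanSpace ℝ (Fin n), ‖x‖ = 1 → ∃ y ∈ N, ‖x - y‖ ≤ ε)
    (hN₀ : ∀ x : EuclideanSpace ℝ (Fin n), ‖x‖ = 1 → IsFlat μ x → ∃ y ∈ N₀, ‖x - y‖ ≤ ε)
    (hsq : ∀ y ∈ N, ∑ i, (a i ⬝ᵥ y.ofLp) ^ 2 ≤ B * m)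
    (hcount : ∀ y ∈ N, ∀ y₀ ∈ N₀,
      q / 4 * m ≤ ∑ i, (largePair t y y₀).indicator (fun _ => (1 : ℝ)) (a i))
    {x x₀ : EuclideanSpace ℝ (Fin n)} (hx : ‖x‖ = 1) (hx₀ : ‖x₀‖ = 1) (hflat : IsFlat μ x₀) :
    q * t ^ 2 / 32 * m ≤ ∑ i, |a i ⬝ᵥ x.ofLp| * |a i ⬝ᵥ x₀.ofLp| := by
  obtain ⟨y, hy, hxy⟩ := hN x hx
  obtain ⟨y₀, hy₀, hxy₀⟩ := hN₀ x₀ hx₀ hflat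
  exact sum_abs_mul_abs_ge_of_close a ht hB hsmall
    (sum_dotProduct_sq_le_of_net a (by positivity) hε hN hsq) hxy hxy₀ (hcount y hy y₀ hy₀)

/-- Union bound over the nets: outside an event of probability at most `exp (-n)`, the quadratic
bound holds at every point of `N`, and a proportion `q / 4` of the `aᵢ` is large on every pair in
`N × N₀`. -/
theorem measureReal_exists_bad_le {D : Measure ℝ} [IsProbabilityMeasure D] {l μ t q Λ r : ℝ}
    (hl : 0 < l)
    {m n : ℕ} (hexp : ∀ x : EuclideanSpace ℝ (Fin n), ‖x‖ = 1 →
      Integrable (fun b : Fin n → ℝ => Real.exp (l * (b ⬝ᵥ x.ofLp) ^ 2)) (Measure.pi fun _ => D) ∧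
      ∫ b : Fin n → ℝ, Real.exp (l * (b ⬝ᵥ x.ofLp) ^ 2) ∂(Measure.pi fun _ => D) ≤ 10)
    (hball : ∀ x x₀ : EuclideanSpace ℝ (Fin n), ‖x‖ = 1 → ‖x₀‖ = 1 → IsFlat μ x₀ →
      q ≤ (Measure.pi fun _ : Fin n => D).real (largePair t x x₀))
    {N N₀ : Finset (EuclideanSpace ℝ (Fin n))} (hN : ∀ y ∈ N, ‖y‖ = 1)
    (hN₀ : ∀ y ∈ N₀, ‖y‖ = 1 ∧ IsFlat μ y) (hNcard : (N.card : ℝ) ≤ Real.exp (n * Λ))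
    (hN₀card : (N₀.card : ℝ) ≤ Real.exp (n * Λ)) (hΛ : 0 ≤ Λ) (hr : r ≤ 1) (hrq : r ≤ q / 4)
    (hn : 1 ≤ n) (hm : (2 * Λ + 2) * n ≤ r * m) :
    (measurementLaw D m n).real
      ((⋃ y ∈ N, {a | 4 / l * m ≤ ∑ i, (a i ⬝ᵥ y.ofLp) ^ 2}) ∪
        ⋃ p ∈ N ×ˢ N₀, {a | ∑ i, (largePair t p.1 p.2).indicator (fun _ => (1 : ℝ)) (a i) ≤
          q / 4 * m}) ≤ Real.exp (-n) := by
  have hm0 : (0 : ℝ) ≤ m := Nat.cast_nonneg m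
  have hn1 : (1 : ℝ) ≤ n := by exact_mod_cast hn
  have hnΛ : 0 ≤ n * Λ := by positivity
  have h1 := measureReal_biUnion_le_exp (measurementLaw D m n) hNcard
    (A := fun y => {a | 4 / l * m ≤ ∑ i, (a i ⬝ᵥ y.ofLp) ^ 2}) (w := r * m) fun y hy => by
      refine (measureReal_le_sum_dotProduct_sq_le hl (hexp y (hN y hy)).1
        (hexp y (hN y hy)).2 m).trans (Real.exp_le_exp.2 (neg_le_neg ?_))
      exact mul_le_of_le_one_left hm0 hr
  have hcard : ((N ×ˢ N₀).card : ℝ) ≤ Real.exp (n * Λ + n * Λ) := by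
    rw [Finset.card_product, Nat.cast_mul, Real.exp_add]
    gcongr
  have h2 := measureReal_biUnion_le_exp (measurementLaw D m n) hcard
    (A := fun p => {a | ∑ i, (largePair t p.1 p.2).indicator (fun _ => (1 : ℝ)) (a i) ≤
      q / 4 * m}) (w := r * m) fun p hp => by
      obtain ⟨hp1, hp2⟩ := Finset.mem_product.1 hp
      refine (measureReal_pi_sum_indicator_le (measurableSet_largePair t p.1 p.2)
        (hball p.1 p.2 (hN _ hp1) (hN₀ _ hp2).1 (hN₀ _ hp2).2) m).trans ?_
      rw [← Real.exp_nat_mul, Real.exp_le_exp, mul_neg, neg_le_neg_iff, mul_comm (m : ℝ)]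
      gcongr
  have h3 : Real.exp (n * Λ - r * m) ≤ Real.exp (-n + -n) := Real.exp_le_exp.2 (by linarith)
  have h4 : Real.exp (n * Λ + n * Λ - r * m) ≤ Real.exp (-n + -n) :=
    Real.exp_le_exp.2 (by linarith)
  have h5 : Real.exp (-n + -n : ℝ) ≤ Real.exp (-n) * (1 / 2) := by
    rw [Real.exp_add]
    gcongr
    rw [Real.exp_neg, inv_le_comm₀ (Real.exp_pos _) (by norm_num)]
    have := Real.add_one_le_exp (n : ℝ)
    norm_num
    linarith
  refine (measureReal_union_le _ _).trans ?_
  linarith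

end PhaseLift

theorem mainTheorem6 (D : MeasureTheory.Measure ℝ) [MeasureTheory.IsProbabilityMeasure D]
    (hD : PhaseLift.IsSubgaussian D)
    (hmean : ∫ x, x ∂D = 0)
    (hvar : ProbabilityTheory.variance (fun x : ℝ => x) D = 1) :
    ∃ μ κ₀ c α : ℝ, 0 < μ ∧ μ < 1 ∧ 1 < κ₀ ∧ 0 < c ∧ 0 < α ∧
      ∃ N : ℕ, ∀ n : ℕ, N ≤ n → ∀ m : ℕ, κ₀ * (n : ℝ) ≤ (m : ℝ) →
        1 - Real.exp (-(c * (n : ℝ))) ≤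
          (PhaseLift.measurementLaw D m n).real
            {a : Fin m → Fin n → ℝ |
              ∀ x₀ ∈ PhaseLift.flatVectors n μ \ {0},
                ∀ X ∈ PhaseLift.tangentSpace x₀ \ {0},
                  α * PhaseLift.operatorNorm X ≤
                    (1 / (m : ℝ)) * PhaseLift.l1Norm (PhaseLift.samplingOperator a X)} := by
  obtain ⟨l, hl, hexp⟩ := hD.exists_integral_exp_dotProduct_sq_le hmean
  obtain ⟨μ, t, q, hμ0, hμ1, ht, hq, hball⟩ := hD.exists_joint_smallBall hmean hvar
  -- With `B = 4 / l`, the constant in `∑ ⟨aᵢ, y⟩² ≤ B m`, this `ε` makes the error from the nets at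
  -- most half of the main term.
  set ε : ℝ := min (1 / 2) (Real.sqrt (q * t ^ 2 / (256 * (4 / l)))) with hε
  have hε0 : 0 < ε := by positivity
  have hε2 : ε ≤ 1 / 2 := min_le_left _ _
  have hsmall : 256 * (4 / l) * ε ^ 2 ≤ q * t ^ 2 := by
    rw [← le_div_iff₀' (by positivity),
      ← Real.sq_sqrt (show 0 ≤ q * t ^ 2 / (256 * (4 / l)) by positivity)]
    exact pow_le_pow_left₀ hε0.le (min_le_right _ _) 2
  have hΛ0 : 0 ≤ Real.log (3 / ε) := Real.log_nonneg ((one_le_div hε0).2 (by linarith))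
  have hr0 : 0 < min 1 (q / 4) := by positivity
  have hr1 : min 1 (q / 4) ≤ 1 := min_le_left _ _
  -- `κ₀` is chosen so that the union bound over `(3 / ε) ^ (2 n)` pairs leaves `exp (-2 n)`.
  refine ⟨μ, (2 * Real.log (3 / ε) + 2) / min 1 (q / 4), 1, q * t ^ 2 / 32, hμ0, hμ1, ?_, one_pos,
    by positivity, 1, fun n hn m hm => ?_⟩
  · rw [one_lt_div hr0]; linarith
  have hn1 : (1 : ℝ) ≤ n := by exact_mod_cast hn
  have hm0 : (0 : ℝ) < m := 
    (mul_pos (div_pos (by linarith) hr0) (by linarith)).trans_le hm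
  rw [div_mul_eq_mul_div, div_le_iff₀' hr0] at hm
  obtain ⟨N, hNS, hNcard, hN⟩ := PhaseLift.exists_finset_net hε0 (hε2.trans (by norm_num))
    (S := {x : EuclideanSpace ℝ (Fin n) | ‖x‖ = 1}) fun x hx => le_of_eq hx
  obtain ⟨N₀, hN₀S, hN₀card, hN₀⟩ := PhaseLift.exists_finset_net hε0 (hε2.trans (by norm_num))
    (S := {x : EuclideanSpace ℝ (Fin n) | ‖x‖ = 1 ∧ PhaseLift.IsFlat μ x})
    fun x hx => le_of_eq hx.1
  rw [finrank_euclideanSpace_fin, ← Real.exp_log (show 0 < 3 / ε by positivity),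
    ← Real.exp_nat_mul] at hNcard hN₀card
  have hbad := PhaseLift.measureReal_exists_bad_le hl (hexp n) (hball n) (fun y hy => hNS hy)
    (fun y hy => hN₀S hy) hNcard hN₀card hΛ0 hr1 (min_le_right _ _) hn hm
  have hprob : MeasureTheory.IsProbabilityMeasure (PhaseLift.measurementLaw D m n) := by
    unfold PhaseLift.measurementLaw; infer_instance
  rw [one_mul, sub_le_iff_le_add]
  refine (MeasureTheory.probReal_univ
    (μ := PhaseLift.measurementLaw D m n)).symm.le.trans (le_trans ?_ (add_le_add_right hbad _))
  -- The good event need not be measurable: only subadditivity of the outer measure is used.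
  refine le_trans (MeasureTheory.measureReal_mono fun a _ => ?_)
    (MeasureTheory.measureReal_union_le _ _)
  refine or_iff_not_imp_right.2 fun ha x₀ hx₀ X hX => ?_
  refine PhaseLift.operatorNorm_le_l1Norm_of_unit (β := q * t ^ 2 / 32) (by exact_mod_cast hm0)
    (by positivity) ?_ hx₀ hX.1
  intro x x₀ hx hx₀ hflat
  refine PhaseLift.sum_abs_mul_abs_ge_of_nets ht (by positivity) hε2 hsmall hN
    (fun x h1 h2 => hN₀ x ⟨h1, h2⟩) ?_ ?_ hx hx₀ hflat
  · intro y hy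
    by_contra! hlt
    exact ha (Or.inl (Set.mem_biUnion hy hlt.le))
  · intro y hy y₀ hy₀
    by_contra! hlt
    exact ha (Or.inr (Set.mem_biUnion (x := (y, y₀)) (Finset.mk_mem_product hy hy₀) hlt.le))
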